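/- For a finite group $G$ with normal subgroups $M\le N$, both nontrivial and proper in $G$, call $(G,N,M)$ a Frobenius triple if $C_G(x)\le N$ for every $1\neq x\in M$. The Fitting subgroup $F(G)$ of $G$ is the subgroup generated by all nilpotent normal subgroups of $G$, the upper Fitting series is given by $F_0(G)=1$ and $F_{i+1}(G)/F_i(G)=F(G/F_i(G))$, and the Fitting height $h(G)$ is the least $i$ with $F_i(G)=G$ (with $h(G)=\infty$ if there is no such $i$). For every positive integer $n$ there exists a Frobenius triple $(G,N,M)$, with $G$ a finite group, such that $h(M)=n$. -/

import Mathlib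

/-- `(G, N, M)` is a Frobenius triple: `M ≤ N` are nontrivial proper normal subgroups of `G`,
and `C_G(x) ≤ N` for every nonidentity element `x` of `M`. -/
structure IsFrobeniusTriple (G : Type*) [Group G] (N M : Subgroup G) : Prop where
  normal_N : N.Normal
  normal_M : M.Normal
  N_ne_bot : N ≠ ⊥
  N_ne_top : N ≠ ⊤
  M_ne_bot : M ≠ ⊥
  M_ne_top : M ≠ ⊤
  le : M ≤ N
  centralizer_le : ∀ x ∈ M, x ≠ 1 → Subgroup.centralizer {x} ≤ N

/-- The Fitting subgroup `F(G)`: the subgroup generated by all nilpotent normal subgroups. -/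
def fittingSubgroup (G : Type*) [Group G] : Subgroup G :=
  sSup {K : Subgroup G | K.Normal ∧ Group.IsNilpotent K}

theorem fittingSubgroup_normal (G : Type*) [Group G] : (fittingSubgroup G).Normal :=
  Subgroup.sSup_normal _ fun _ hK => hK.1

/-- The upper Fitting series `F_i(G)`, bundled with normality: `F_0(G) = 1`, and `F_{i+1}(G)` is
the preimage in `G` of the Fitting subgroup of `G / F_i(G)`. -/
def upperFittingSeriesAux (G : Type*) [Group G] : ℕ → {K : Subgroup G // K.Normal}
  | 0 => ⟨⊥, inferInstance⟩
  | i + 1 =>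
    haveI := (upperFittingSeriesAux G i).2
    haveI := fittingSubgroup_normal (G ⧸ (upperFittingSeriesAux G i).1)
    ⟨(fittingSubgroup (G ⧸ (upperFittingSeriesAux G i).1)).comap
      (QuotientGroup.mk' (upperFittingSeriesAux G i).1), inferInstance⟩

/-- The `i`-th term `F_i(G)` of the upper Fitting series of `G`. -/
def upperFittingSeries (G : Type*) [Group G] (i : ℕ) : Subgroup G :=
  (upperFittingSeriesAux G i).1

/-- The Fitting height `h(G)`: the least `i` with `F_i(G) = G`, and `⊤` if there is none
(which for a finite group means that it is not solvable). -/
noncomputable def fittingHeight (G : Type*) [Group G] : ℕ∞ :=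
  ⨅ (i : ℕ) (_ : upperFittingSeries G i = ⊤), (i : ℕ∞)

/-! Let `α` be a fixed-point-free automorphism of 2-power order of a finite group `M ≠ 1`; take `G =
M ⋊ ⟨α⟩` and `N = M ⋊ ⟨α²⟩`. An element outside `N` acts on `M` as an inner automorphism times a
generator `β` of `⟨α⟩`. As `β` is fixed-point-free, so is its whole coset `Inn(M) β`
(`MonoidHom.FixedPointFree.eq_one_of_conj`), hence no such element centralizes a nonidentity element
of `M`.

It remains to find such `M` of each height `n`, by induction with `α ^ 2 ^ n = 1`. For a prime `q >
|M|` with `q ≡ 1` mod `2 ^ (n + 1)`, let `V` be the functions `M → ZMod q`. The action on `V` is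
faithful and coprime, so `V = F(V ⋊ M)` (`fittingSubgroup_semidirectProduct`) and the height grows
by one. Extend `α` to `V` by `f ↦ l • (f ∘ α⁻¹)` with `l` of order `2 ^ (n + 1)`: its `2 ^ n`-th
power is the scalar `l ^ 2 ^ n ≠ 1` on `V`, so no fixed points appear. -/

/-! ### The upper Fitting series under surjections -/

/-- Group isomorphisms carry the Fitting subgroup into the Fitting subgroup. -/
theorem map_fittingSubgroup_le {A B : Type*} [Group A] [Group B] (e : A ≃* B) :
    (fittingSubgroup A).map e.toMonoidHom ≤ fittingSubgroup B := by
  rw [Subgroup.map_le_iff_le_comap]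
  refine sSup_le fun K hK => Subgroup.map_le_iff_le_comap.mp (le_sSup ⟨?_, ?_⟩)
  · exact hK.1.map _ e.surjective
  · have := hK.2
    exact Group.nilpotent_of_mulEquiv (K.equivMapOfInjective e.toMonoidHom e.injective)

theorem comap_fittingSubgroup_eq {A B : Type*} [Group A] [Group B] (e : A ≃* B) :
    (fittingSubgroup B).comap e.toMonoidHom = fittingSubgroup A := by
  refine le_antisymm (fun x hx => ?_) (Subgroup.map_le_iff_le_comap.mp (map_fittingSubgroup_le e))
  simpa using map_fittingSubgroup_le e.symm (Subgroup.mem_map_of_mem e.symm.toMonoidHom hx)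

theorem upperFittingSeries_zero (G : Type*) [Group G] : upperFittingSeries G 0 = ⊥ := rfl

instance upperFittingSeries_normal (G : Type*) [Group G] (i : ℕ) :
    (upperFittingSeries G i).Normal := (upperFittingSeriesAux G i).2

theorem upperFittingSeries_succ (G : Type*) [Group G] (i : ℕ) :
    upperFittingSeries G (i + 1) = (fittingSubgroup (G ⧸ upperFittingSeries G i)).comap
      (QuotientGroup.mk' (upperFittingSeries G i)) := rfl

/-- `F_{i+1}(G)` can be computed in any model of the quotient `G / F_i(G)`. -/
theorem upperFittingSeries_succ_eq_comap {G Q : Type*} [Group G] [Group Q] (f : G →* Q)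
    (hf : Function.Surjective f) {i : ℕ} (hi : f.ker = upperFittingSeries G i) :
    upperFittingSeries G (i + 1) = (fittingSubgroup Q).comap f := by
  let e : G ⧸ upperFittingSeries G i ≃* Q :=
    (QuotientGroup.quotientMulEquivOfEq hi.symm).trans
      (QuotientGroup.quotientKerEquivOfSurjective f hf)
  rw [upperFittingSeries_succ, ← comap_fittingSubgroup_eq e, Subgroup.comap_comap]
  rfl

/-- Quotienting by `F_j(G)` shifts the upper Fitting series by `j`. -/
theorem upperFittingSeries_add {G H : Type*} [Group G] [Group H] (f : G →* H)
    (hf : Function.Surjective f) {j : ℕ} (hj : f.ker = upperFittingSeries G j) (i : ℕ) :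
    upperFittingSeries G (j + i) = (upperFittingSeries H i).comap f := by
  induction i with
  | zero => rw [upperFittingSeries_zero, MonoidHom.comap_bot, hj, add_zero]
  | succ i ih =>
    rw [← add_assoc, upperFittingSeries_succ_eq_comap
      ((QuotientGroup.mk' (upperFittingSeries H i)).comp f)
      ((QuotientGroup.mk'_surjective _).comp hf), upperFittingSeries_succ, Subgroup.comap_comap]
    rw [← MonoidHom.comap_ker, QuotientGroup.ker_mk', ih]

theorem comap_eq_top_iff_of_surjective {G H : Type*} [Group G] [Group H] {f : G →* H}
    (hf : Function.Surjective f) {K : Subgroup H} : K.comap f = ⊤ ↔ K = ⊤ := by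
  rw [← Subgroup.comap_top f, (Subgroup.comap_injective hf).eq_iff]

theorem upperFittingSeries_eq_top_iff_of_mulEquiv {A B : Type*} [Group A] [Group B] (e : A ≃* B)
    (i : ℕ) : upperFittingSeries A i = ⊤ ↔ upperFittingSeries B i = ⊤ := by
  have h := upperFittingSeries_add e.toMonoidHom e.surjective (j := 0)
    ((MonoidHom.ker_eq_bot_iff _).mpr e.injective) i
  rw [zero_add] at h
  rw [h, comap_eq_top_iff_of_surjective e.surjective]

theorem upperFittingSeries_one (G : Type*) [Group G] :
    upperFittingSeries G 1 = fittingSubgroup G :=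
  upperFittingSeries_succ_eq_comap (MonoidHom.id G) Function.surjective_id (i := 0)
    ((MonoidHom.ker_eq_bot_iff _).mpr Function.injective_id)

theorem upperFittingSeries_succ_eq_top_iff {G H : Type*} [Group G] [Group H] (f : G →* H)
    (hf : Function.Surjective f) (hker : fittingSubgroup G = f.ker) (i : ℕ) :
    upperFittingSeries G (i + 1) = ⊤ ↔ upperFittingSeries H i = ⊤ := by
  rw [add_comm, upperFittingSeries_add f hf (by rw [upperFittingSeries_one, hker]),
    comap_eq_top_iff_of_surjective hf]

theorem fittingHeight_eq_of_forall_iff {G : Type*} [Group G] {n : ℕ}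
    (h : ∀ i, upperFittingSeries G i = ⊤ ↔ n ≤ i) : fittingHeight G = n := by
  refine le_antisymm (iInf₂_le n ((h n).mpr le_rfl)) (le_iInf₂ fun i hi => ?_)
  exact_mod_cast (h i).mp hi

/-! ### The Fitting subgroup of a semidirect product with a coprime faithful module -/

section SemidirectModule

variable {k M V : Type*} [CommRing k] [Group M] [AddCommGroup V] [Module k V]

/-- A representation, as an action by automorphisms on the underlying group written
multiplicatively. -/
def Representation.toMulAut (ρ : Representation k M V) : M →* MulAut (Multiplicative V) where
  toFun m := AddEquiv.toMultiplicative
    { toFun := ρ m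
      invFun := ρ m⁻¹
      left_inv := fun v => by simp
      right_inv := fun v => by simp
      map_add' := map_add (ρ m) }
  map_one' := by ext v; simp
  map_mul' a b := by ext v; simp

@[simp] theorem Representation.toMulAut_apply (ρ : Representation k M V) (m : M)
    (v : Multiplicative V) :
    ρ.toMulAut m v = Multiplicative.ofAdd (ρ m v.toAdd) := rfl

open SemidirectProduct commutatorElement in
theorem inl_sub_one_apply (ρ : Representation k M V) (g : Multiplicative V ⋊[ρ.toMulAut] M)
    (w : V) :
    (inl (Multiplicative.ofAdd ((ρ g.right - 1) w)) : Multiplicative V ⋊[ρ.toMulAut] M) =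
      ⁅(inl (Multiplicative.ofAdd w) : Multiplicative V ⋊[ρ.toMulAut] M)⁻¹, g⁆ := by
  rw [commutatorElement_def, inv_inv, eq_mul_inv_iff_mul_eq]
  refine SemidirectProduct.ext (Multiplicative.toAdd.injective ?_) ?_
  · simp only [mul_left, left_inl, right_inl, map_one, MulAut.one_apply, ← map_inv,
      Representation.toMulAut_apply, mul_right, one_mul, toAdd_mul, toAdd_inv, toAdd_ofAdd,
      LinearMap.sub_apply, Module.End.one_apply]
    abel
  · simp only [mul_right, right_inl, ← map_inv, one_mul, mul_one]

-- Applying `ρ g - 1` on `V` is taking a commutator with `g`. Normality of `K` puts the first one in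
-- `K`, and each further one descends a step; so nilpotency of `K` will make `ρ g` unipotent.
open SemidirectProduct commutatorElement in
theorem inl_sub_one_pow_mem_lowerCentralSeries (ρ : Representation k M V)
    (K : Subgroup (Multiplicative V ⋊[ρ.toMulAut] M)) [hK : K.Normal]
    {g : Multiplicative V ⋊[ρ.toMulAut] M} (hg : g ∈ K) (w : V) (i : ℕ) :
    inl (Multiplicative.ofAdd (((ρ g.right - 1) ^ (i + 1)) w)) ∈ K.lowerCentralSeries i := by
  induction i with
  | zero =>
    rw [zero_add, pow_one, inl_sub_one_apply, Subgroup.lowerCentralSeries_zero,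
      commutatorElement_def]
    exact K.mul_mem (hK.conj_mem _ hg _) (K.inv_mem hg)
  | succ i ih =>
    rw [pow_succ', Module.End.mul_apply, inl_sub_one_apply, Subgroup.lowerCentralSeries_succ]
    exact Subgroup.commutator_mem_commutator (inv_mem ih) hg

/-- If a group `M` of order prime to `q` acts faithfully on a vector space `V` of characteristic
`q`, then `V` is the Fitting subgroup of `V ⋊ M`. -/
theorem fittingSubgroup_semidirectProduct {k M V : Type*} [Field k] [Group M] [Finite M]
    [AddCommGroup V] [Module k V] {q : ℕ} [Fact q.Prime] [CharP k q]
    (ρ : Representation k M V) (hρ : Function.Injective ρ) (hq : (Nat.card M).Coprime q) :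
    fittingSubgroup (Multiplicative V ⋊[ρ.toMulAut] M) =
      (SemidirectProduct.rightHom : Multiplicative V ⋊[ρ.toMulAut] M →* M).ker := by
  refine le_antisymm (sSup_le ?_) (le_sSup ⟨inferInstance, ?_⟩)
  · rintro K ⟨hK, hnil⟩ g hg
    obtain ⟨c, hc⟩ := K.isNilpotent_iff_lowerCentralSeries.mp hnil
    have hzero : (ρ g.right - 1) ^ (c + 1) = 0 := by
      ext w
      have := inl_sub_one_pow_mem_lowerCentralSeries ρ K hg w c
      rw [hc, Subgroup.mem_bot] at this
      simpa using congrArg (fun x => x.left.toAdd) this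
    -- With a power of `q` as exponent, Frobenius turns this into `ρ g ^ q ^ (c + 1) = 1`;
    -- coprimality then forces `g.right = 1`.
    have hpow : (ρ g.right - 1) ^ q ^ (c + 1) = 0 :=
      pow_eq_zero_of_le (Nat.lt_pow_self (Fact.out : q.Prime).one_lt).le hzero
    have hfix : ρ (g.right ^ q ^ (c + 1)) = 1 := by
      rcases subsingleton_or_nontrivial V with _ | _
      · exact LinearMap.ext fun w => Subsingleton.elim _ _
      · have : CharP (Module.End k V) q :=
          charP_of_injective_algebraMap (algebraMap k (Module.End k V)).injective q
        rw [sub_pow_char_pow_of_commute q _ (Commute.one_right _), one_pow, sub_eq_zero] at hpow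
        rw [map_pow, hpow]
    have hone : g.right ^ q ^ (c + 1) = 1 := hρ (hfix.trans (map_one ρ).symm)
    have hord : orderOf g.right = 1 :=
      Nat.eq_one_of_dvd_coprimes (hq.pow_right (c + 1)) (orderOf_dvd_natCard _)
        (orderOf_dvd_of_pow_eq_one hone)
    exact orderOf_eq_one_iff.mp hord
  · rw [← SemidirectProduct.range_inl_eq_ker_rightHom]
    exact Group.nilpotent_of_surjective _
      (SemidirectProduct.inl (φ := ρ.toMulAut)).rangeRestrict_surjective

end SemidirectModule

/-! ### The inductive construction -/

section Translation

variable (q : ℕ) (M : Type*) [Group M]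

/-- The regular representation on functions: `(m • f) x = f (x * m)`. -/
def translationRep : Representation (ZMod q) M (M → ZMod q) where
  toFun m := LinearMap.funLeft (ZMod q) (ZMod q) (· * m)
  map_one' := by ext f x; simp
  map_mul' a b := by ext f x; simp [mul_assoc]

@[simp] theorem translationRep_apply (m : M) (f : M → ZMod q) (x : M) :
    translationRep q M m f x = f (x * m) := rfl

theorem translationRep_injective [Fact q.Prime] : Function.Injective (translationRep q M) := by
  classical
  intro a b h
  have := congrFun (LinearMap.congr_fun h (Pi.single a 1)) 1
  by_contra hab
  simp [Ne.symm hab] at this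

variable {q M}

/-- The automorphism `f ↦ l • (f ∘ α⁻¹)` of the group of functions `M → ZMod q`. -/
def twistAut (l : (ZMod q)ˣ) (α : MulAut M) : MulAut (Multiplicative (M → ZMod q)) :=
  AddEquiv.toMultiplicative
    { toFun := fun f x => l * f (α⁻¹ x)
      invFun := fun f x => (l⁻¹ : (ZMod q)ˣ) * f (α x)
      left_inv := fun f => funext fun x => by simp
      right_inv := fun f => funext fun x => by simp
      map_add' := fun f g => funext fun x => by simp [mul_add] }

@[simp] theorem twistAut_apply (l : (ZMod q)ˣ) (α : MulAut M) (f : Multiplicative (M → ZMod q))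
    (x : M) : (twistAut l α f).toAdd x = l * f.toAdd (α⁻¹ x) := rfl

theorem twistAut_pow (l : (ZMod q)ˣ) (α : MulAut M) (i : ℕ) :
    twistAut l α ^ i = twistAut (l ^ i) (α ^ i) := by
  induction i with
  | zero => exact MulEquiv.ext fun f => Multiplicative.toAdd.injective (funext fun x => by simp)
  | succ i ih =>
    refine MulEquiv.ext fun f => Multiplicative.toAdd.injective (funext fun x => ?_)
    rw [pow_succ', MulAut.mul_apply, ih, twistAut_apply, twistAut_apply, twistAut_apply,
      pow_succ', pow_succ', mul_inv_rev, MulAut.mul_apply, Units.val_mul, mul_assoc]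

/-- The automorphism of `(M → ZMod q) ⋊ M` that acts by `twistAut l α` on functions and by `α` on
`M`. -/
def semidirectTwistAut (l : (ZMod q)ˣ) (α : MulAut M) :
    MulAut (Multiplicative (M → ZMod q) ⋊[(translationRep q M).toMulAut] M) :=
  SemidirectProduct.congr (twistAut l α) α fun m => by
    -- Both sides send `f` to `x ↦ l * f (α⁻¹ x * m)`, which is why `twistAut` precomposes with
    -- `α⁻¹`.
    refine MulEquiv.ext fun f => Multiplicative.toAdd.injective (funext fun x => ?_)
    simp

theorem semidirectTwistAut_apply (l : (ZMod q)ˣ) (α : MulAut M)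
    (g : Multiplicative (M → ZMod q) ⋊[(translationRep q M).toMulAut] M) :
    semidirectTwistAut l α g = ⟨twistAut l α g.left, α g.right⟩ := rfl

theorem semidirectTwistAut_pow_apply (l : (ZMod q)ˣ) (α : MulAut M) (i : ℕ)
    (g : Multiplicative (M → ZMod q) ⋊[(translationRep q M).toMulAut] M) :
    (semidirectTwistAut l α ^ i) g = ⟨(twistAut l α ^ i) g.left, (α ^ i) g.right⟩ := by
  induction i with
  | zero => rfl
  | succ i ih =>
    simp only [pow_succ', MulAut.mul_apply, ih, semidirectTwistAut_apply]

theorem fixedPointFree_semidirectTwistAut [Fact q.Prime] {l : (ZMod q)ˣ} {α : MulAut M}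
    (hα : MonoidHom.FixedPointFree α) {r : ℕ} (hr : α ^ r = 1) (hl : l ^ r ≠ 1) :
    MonoidHom.FixedPointFree (semidirectTwistAut l α) := by
  intro g hg
  rw [semidirectTwistAut_apply] at hg
  have hright : g.right = 1 := hα _ (congrArg SemidirectProduct.right hg)
  have hleft : twistAut l α g.left = g.left := congrArg SemidirectProduct.left hg
  have hpow : (twistAut l α ^ r) g.left = g.left := by
    have hfix : ∀ i : ℕ, (twistAut l α ^ i) g.left = g.left := fun i => by
      induction i with
      | zero => rfl
      | succ i ih => rw [pow_succ', MulAut.mul_apply, ih, hleft]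
    exact hfix r
  rw [twistAut_pow, hr] at hpow
  refine SemidirectProduct.ext (Multiplicative.toAdd.injective (funext fun x => ?_)) hright
  have hx : (l ^ r : (ZMod q)ˣ) * g.left.toAdd x = g.left.toAdd x :=
    congrFun (congrArg Multiplicative.toAdd hpow) x
  by_contra h0
  exact hl (Units.ext (mul_right_cancel₀ h0 (hx.trans (one_mul _).symm)))

end Translation

theorem exists_unit_orderOf_eq {q d : ℕ} [Fact q.Prime] (h : q ≡ 1 [MOD d]) :
    ∃ l : (ZMod q)ˣ, orderOf l = d := by
  obtain ⟨g, hg⟩ := IsCyclic.exists_generator (α := (ZMod q)ˣ)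
  have hcard : orderOf g = q - 1 := by
    rw [orderOf_eq_card_of_forall_mem_zpowers hg, Nat.card_eq_fintype_card, ZMod.card_units]
  have hdvd : d ∣ orderOf g := by
    rw [hcard]
    exact (Nat.modEq_iff_dvd' (Fact.out : q.Prime).one_lt.le).mp h.symm
  exact ⟨_, orderOf_pow_orderOf_div (orderOf_pos g).ne' hdvd⟩

/-- There are finite groups of every Fitting height with a fixed-point-free automorphism of
2-power order. -/
theorem exists_fixedPointFree_fittingHeight (n : ℕ) :
    ∃ (M : Type) (_ : Group M) (_ : Finite M) (α : MulAut M),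
      α ^ 2 ^ n = 1 ∧ MonoidHom.FixedPointFree α ∧
        ∀ i, upperFittingSeries M i = ⊤ ↔ n ≤ i := by
  induction n with
  | zero =>
    refine ⟨Unit, inferInstance, inferInstance, 1, one_pow _, fun _ _ => rfl, fun i => ?_⟩
    simp [Subsingleton.elim (upperFittingSeries Unit i) ⊤]
  | succ n ih =>
    obtain ⟨M, _, _, α, hα, hfree, hM⟩ := ih
    -- The modulus has one factor 2 more than the exponent killing `α`, so that `l ^ 2 ^ n ≠ 1`; `q
    -- > |M|` gives coprimality.
    obtain ⟨q, hq, hlt, hmod⟩ :=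
      Nat.exists_prime_gt_modEq_one (k := 2 ^ (n + 1)) (Nat.card M) (by positivity)
    have : Fact q.Prime := ⟨hq⟩
    obtain ⟨l, hl⟩ := exists_unit_orderOf_eq hmod
    have hcop : (Nat.card M).Coprime q :=
      (Nat.coprime_of_lt_prime Nat.card_pos.ne' hlt hq).symm
    have hfit := fittingSubgroup_semidirectProduct (translationRep q M)
      (translationRep_injective q M) hcop
    refine ⟨Multiplicative (M → ZMod q) ⋊[(translationRep q M).toMulAut] M, inferInstance,
      Finite.of_equiv _ SemidirectProduct.equivProd.symm, semidirectTwistAut l α, ?_, ?_, ?_⟩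
    · have hα' : α ^ 2 ^ (n + 1) = 1 := by rw [pow_succ, pow_mul, hα, one_pow]
      ext g : 1
      rw [semidirectTwistAut_pow_apply, twistAut_pow, hα', ← hl, pow_orderOf_eq_one,
        ← pow_zero l, ← pow_zero (1 : MulAut M), ← twistAut_pow]
      rfl
    · refine fixedPointFree_semidirectTwistAut hfree hα fun h => ?_
      have := Nat.le_of_dvd (by positivity) (orderOf_dvd_of_pow_eq_one h)
      rw [hl] at this
      exact absurd this (not_le.mpr (Nat.pow_lt_pow_succ one_lt_two))
    · rintro (_ | i)
      · have : Nontrivial (Multiplicative (M → ZMod q) ⋊[(translationRep q M).toMulAut] M) :=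
          SemidirectProduct.inl_injective.nontrivial
        simp [upperFittingSeries_zero, bot_ne_top]
      · rw [upperFittingSeries_succ_eq_top_iff _ SemidirectProduct.rightHom_surjective hfit, hM,
          Nat.succ_le_succ_iff]

/-! ### Frobenius triples from fixed-point-free automorphisms -/

/-- A coset of automorphisms `Inn(M) β` with `β` fixed-point-free consists of fixed-point-free
automorphisms. -/
theorem MonoidHom.FixedPointFree.eq_one_of_conj {M : Type*} [Group M] [Finite M] {β : MulAut M}
    (hβ : MonoidHom.FixedPointFree β) {m a : M} (h : m * β a * m⁻¹ = a) : a = 1 := by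
  -- On a finite group the injective map `y ↦ y / β y` is onto. Writing `m = y / β y` makes `y⁻¹ * a
  -- * y` a fixed point of `β`.
  obtain ⟨y, hy⟩ := hβ.commutatorMap_surjective m
  have hy' : β y = m⁻¹ * y := by
    rw [← hy, MonoidHom.commutatorMap_apply, inv_div, div_mul_cancel]
  have hb : y⁻¹ * a * y = 1 := hβ _ <| by
    have ha : β a = m⁻¹ * a * m := by
      conv_rhs => rw [← h]
      group
    rw [map_mul, map_mul, map_inv, hy', ha]
    group
  have : a = y * (y⁻¹ * a * y) * y⁻¹ := by group
  rw [this, hb]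
  group

theorem MonoidHom.FixedPointFree.of_mem_zpowers {M : Type*} [Group M] {α β : MulAut M}
    (hα : MonoidHom.FixedPointFree α) (h : α ∈ Subgroup.zpowers β) :
    MonoidHom.FixedPointFree β := by
  intro x hx
  have hle : Subgroup.zpowers β ≤ MulAction.stabilizer (MulAut M) x :=
    Subgroup.zpowers_le.mpr hx
  exact hα x (hle h)

/-- Outside the squares only odd powers of `a` remain, and these generate a cyclic 2-group. -/
theorem mem_zpowers_of_notMem_zpowers_sq {A : Type*} [Group A] {a b : A} {n : ℕ}
    (ha : a ^ 2 ^ n = 1) (hb : b ∈ Subgroup.zpowers a) (hb' : b ∉ Subgroup.zpowers (a ^ 2)) :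
    a ∈ Subgroup.zpowers b := by
  have hfin : IsOfFinOrder a := isOfFinOrder_iff_pow_eq_one.mpr ⟨2 ^ n, by positivity, ha⟩
  obtain ⟨k, rfl⟩ := hfin.mem_powers_iff_mem_zpowers.mpr hb
  have hk : ¬ 2 ∣ k := by
    rintro ⟨j, rfl⟩
    exact hb' ⟨j, by simp [pow_mul]⟩
  have hcop : k.Coprime (orderOf a) :=
    Nat.Coprime.coprime_dvd_right (orderOf_dvd_of_pow_eq_one ha)
      (((Nat.prime_two.coprime_iff_not_dvd.mpr hk).symm).pow_right n)
  exact mem_zpowers_pow_iff.mpr hcop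

theorem notMem_zpowers_sq {A : Type*} [Group A] {a : A} {n : ℕ}
    (ha : a ^ 2 ^ n = 1) (h1 : a ≠ 1) : a ∉ Subgroup.zpowers (a ^ 2) := by
  intro h
  refine h1 (orderOf_eq_one_iff.mp (Nat.eq_one_of_dvd_coprimes (k := orderOf a)
    (Nat.Coprime.pow_right n (Nat.Coprime.symm (mem_zpowers_pow_iff.mp h))) dvd_rfl
    (orderOf_dvd_of_pow_eq_one ha)))

/-- If `α` is a fixed-point-free automorphism of 2-power order of a nontrivial finite group `M`,
then `(M ⋊ ⟨α⟩, M ⋊ ⟨α²⟩, M)` is a Frobenius triple. -/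
theorem isFrobeniusTriple_of_fixedPointFree {M : Type*} [Group M] [Finite M] [Nontrivial M]
    {α : MulAut M} {n : ℕ} (hα : α ^ 2 ^ n = 1) (hfree : MonoidHom.FixedPointFree α) :
    IsFrobeniusTriple (M ⋊[(Subgroup.zpowers α).subtype] Subgroup.zpowers α)
      (((Subgroup.zpowers (α ^ 2)).subgroupOf (Subgroup.zpowers α)).comap
        SemidirectProduct.rightHom)
      SemidirectProduct.inl.range := by
  set N := ((Subgroup.zpowers (α ^ 2)).subgroupOf (Subgroup.zpowers α)).comap
    (SemidirectProduct.rightHom : M ⋊[(Subgroup.zpowers α).subtype] Subgroup.zpowers α →* _)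
  have hα1 : α ≠ 1 := by
    rintro rfl
    obtain ⟨x, hx⟩ := exists_ne (1 : M)
    exact hx (hfree x rfl)
  have hle : (SemidirectProduct.inl : M →* M ⋊[(Subgroup.zpowers α).subtype] _).range ≤ N := by
    rw [SemidirectProduct.range_inl_eq_ker_rightHom]
    exact Subgroup.ker_le_comap _ _
  have hM : (SemidirectProduct.inl : M →* M ⋊[(Subgroup.zpowers α).subtype] _).range ≠ ⊥ := by
    rw [Ne, MonoidHom.range_eq_bot_iff]
    intro h
    obtain ⟨x, hx⟩ := exists_ne (1 : M)
    exact hx (SemidirectProduct.inl_injective ((DFunLike.congr_fun h x).trans (map_one _).symm))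
  have hNtop : N ≠ ⊤ := by
    intro h
    have hmem : SemidirectProduct.inr ⟨α, Subgroup.mem_zpowers α⟩ ∈ N := by
      rw [h]; exact Subgroup.mem_top _
    exact notMem_zpowers_sq hα hα1 hmem
  refine ⟨?_, ?_, ?_, hNtop, hM, ?_, hle, ?_⟩
  · have : ((Subgroup.zpowers (α ^ 2)).subgroupOf (Subgroup.zpowers α)).Normal :=
      ⟨fun x hx g => by rwa [mul_comm' g x, mul_inv_cancel_right]⟩
    exact this.comap _
  · rw [SemidirectProduct.range_inl_eq_ker_rightHom]
    infer_instance
  · exact fun h => hM (le_bot_iff.mp (h ▸ hle))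
  · exact fun h => hNtop (top_le_iff.mp (h ▸ hle))
  · rintro _ ⟨a, rfl⟩ ha g hg
    by_contra hgN
    have hβ : MonoidHom.FixedPointFree (g.right : MulAut M) :=
      hfree.of_mem_zpowers (mem_zpowers_of_notMem_zpowers_sq hα g.right.2 hgN)
    have hcomm : g * SemidirectProduct.inl a = SemidirectProduct.inl a * g :=
      (Subgroup.mem_centralizer_singleton_iff.mp hg)
    -- The left coordinate of the commutation relation says that `a` is fixed by `β` followed by
    -- conjugation by `g.left`.
    have hleft : g.left * (g.right : MulAut M) a = a * g.left := by
      simpa using congrArg SemidirectProduct.left hcomm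
    exact ha (by rw [hβ.eq_one_of_conj (mul_inv_eq_of_eq_mul hleft), map_one])

theorem mainTheorem6 (n : ℕ) (hn : 0 < n) :
    ∃ (G : Type) (_ : Group G) (_ : Finite G) (N M : Subgroup G),
      IsFrobeniusTriple G N M ∧ fittingHeight M = n := by
  obtain ⟨M, _, _, α, hα, hfree, hM⟩ := exists_fixedPointFree_fittingHeight n
  have : Nontrivial M := by
    by_contra h
    rw [not_nontrivial_iff_subsingleton] at h
    exact absurd ((hM 0).mp (Subsingleton.elim _ _)) (by lia)
  refine ⟨M ⋊[(Subgroup.zpowers α).subtype] Subgroup.zpowers α, inferInstance,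
    Finite.of_equiv _ SemidirectProduct.equivProd.symm, _, _,
    isFrobeniusTriple_of_fixedPointFree hα hfree, fittingHeight_eq_of_forall_iff fun i => ?_⟩
  rw [← hM]
  exact (upperFittingSeries_eq_top_iff_of_mulEquiv
    (MonoidHom.ofInjective SemidirectProduct.inl_injective) i).symm
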